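/- For a group $G$ and a prime $p$, let $\Gamma_p(G)$ be the $p$-local commensurability graph of $G$: its vertices are the finite-index subgroups of $G$, and two distinct vertices $A, B$ are adjacent if and only if $[A : A\cap B]\,[B : A\cap B]$ is a power of $p$. A geodesic in a graph is a finite path whose length (number of edges) equals the distance in the graph between its two end points. A group is called large if it has a finite-index subgroup that admits a surjective homomorphism onto a non-cyclic free group. Let $G$ be a large group. Then for every prime $p$ and every integer $N > 0$ there is an infinite set of geodesics in $\Gamma_p(G)$, each of length greater than $N$, such that any two distinct geodesics in the set lie in different connected components of $\Gamma_p(G)$. -/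

import Mathlib

universe u

/-- A group is large if some finite-index subgroup of it admits a surjective homomorphism onto
a non-cyclic free group (of any rank, finite or infinite). The rank of a free quotient of a
subgroup of `G` is at most the cardinality of `G`, so bases in the universe of `G` suffice. -/
def IsLargeGroup (G : Type u) [Group G] : Prop :=
  ∃ H : Subgroup G, H.FiniteIndex ∧
    ∃ (α : Type u) (f : H →* FreeGroup α), Function.Surjective f ∧ ¬ IsCyclic (FreeGroup α)

/-- The vertices of the `p`-local commensurability graph: the finite-index subgroups of `G`. -/
abbrev FiniteIndexSubgroup (G : Type u) [Group G] : Type u :=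
  {A : Subgroup G // A.FiniteIndex}

/-- The `p`-local commensurability graph `Γ_p(G)`: two distinct finite-index subgroups `A`, `B`
are adjacent if and only if `[A : A ∩ B] * [B : A ∩ B]` is a power of `p`. -/
def pLocalCommensurabilityGraph (p : ℕ) (G : Type u) [Group G] :
    SimpleGraph (FiniteIndexSubgroup G) where
  Adj A B := A ≠ B ∧
    ∃ k : ℕ, (A.1 ⊓ B.1).relIndex A.1 * (A.1 ⊓ B.1).relIndex B.1 = p ^ k
  symm := by
    constructor
    rintro A B ⟨hne, k, hk⟩
    refine ⟨hne.symm, k, ?_⟩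
    rw [inf_comm, mul_comm]
    exact hk
  loopless := ⟨fun A h => h.1 rfl⟩

/-- A (finite) geodesic in a graph: a walk between two vertices whose length is the distance
between them. -/
structure GraphGeodesic {V : Type u} (Γ : SimpleGraph V) where
  /-- the initial vertex -/
  source : V
  /-- the terminal vertex -/
  target : V
  /-- the walk itself -/
  walk : Γ.Walk source target
  /-- the walk is shortest among all walks with the same end points -/
  length_eq_dist : walk.length = Γ.dist source target

/-- The length (number of edges) of a geodesic. -/
def GraphGeodesic.length {V : Type u} {Γ : SimpleGraph V} (γ : GraphGeodesic Γ) : ℕ :=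
  γ.walk.length

/-- The connected component of the graph in which a geodesic lies. -/
def GraphGeodesic.component {V : Type u} {Γ : SimpleGraph V} (γ : GraphGeodesic Γ) :
    Γ.ConnectedComponent :=
  Γ.connectedComponentMk γ.source

/-!
Call `A` and `B` `p`-commensurable if `A ⊓ B` has `p`-power index in both. If `K` is a normal
subgroup of finite index in `G`, then `A ↦ A ⊓ K` preserves this relation; if `f` is a surjective
homomorphism, so does `A ↦ f(A)`. Both maps retract one `p`-local commensurability graph onto
another, so that distances and components of `Γ_p(K)` and `Γ_p(f(G))` survive in `Γ_p(G)`
(`HasDistantPair.of_normal`, `HasDistantPair.of_surjective`). By the Nielsen-Schreier theorem a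
large group has a normal subgroup of finite index that surjects onto a free group `F` of rank at
least two (`IsLargeGroup.exists_normal_surjective`). For a finite group `Q` and any `n ≥ |Q|`, a
homomorphism from `F` to the wreath product of `Q` with `ℤ/n` shows that some normal subgroup of
index `n` in `F` surjects onto `Q` (`exists_normal_index_eq_surjective`). Hence one finite group `Q`
with two distant vertices in one component of `Γ_p(Q)` suffices: varying `n` prime to `p` yields
geodesics whose vertices have indices differing by more than powers of `p`, and these lie in
different components.

The group `Q` is the wreath product of `ℤ/ℓ` with the affine group of a finite field `K` of
characteristic `p`, with `ℓ > |K|` prime. It acts on the functions `K → ℤ/ℓ`. The stabilizer of a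
function is a copy of the affine group, of order `(|K| - 1) |K|`. If `f` and `g` differ at one point
only, their stabilizers meet in a subgroup containing a copy of `Kˣ`, so they are `p`-commensurable;
hence the stabilizers of all functions lie in one component. Conversely, every vertex of this
component has order prime to `ℓ`, hence fixes a function, by averaging. Adjacent vertices `A` and
`B` have an intersection of order divisible by `|K| - 1`, which therefore contains an element acting
on `K` as a generator of `Kˣ` acts about its fixed point; so functions fixed by `A ⊓ B` agree up to
a constant off one point (`TwistedAffine.almostParallel_of_le_stabilizer`). A walk from the
stabilizer of `0` to that of an injective function thus has at least `|K| - 2` steps.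
-/

/-! ### Retracts of graphs -/

section Graphs

variable {V W : Type*} {Γ : SimpleGraph V} {Δ : SimpleGraph W}

theorem exists_walk_length_le_of_adj_or_eq {r : V → W}
    (hr : ∀ a b, Γ.Adj a b → r a = r b ∨ Δ.Adj (r a) (r b)) {a b : V} (w : Γ.Walk a b) :
    ∃ w' : Δ.Walk (r a) (r b), w'.length ≤ w.length := by
  induction w with
  | nil => exact ⟨.nil, le_rfl⟩
  | cons h _ ih =>
    obtain ⟨w', hw'⟩ := ih
    rcases hr _ _ h with h | h
    · rw [h]
      exact ⟨w', hw'.trans (by simp)⟩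
    · exact ⟨.cons h w', by simpa using hw'⟩

/-- A graph which is a retract of another, by maps that may collapse edges, embeds in it without
shortening distances. -/
theorem reachable_and_dist_le_of_retract {i : W → V} {r : V → W} (hri : ∀ a, r (i a) = a)
    (hi : ∀ a b, Δ.Adj a b → i a = i b ∨ Γ.Adj (i a) (i b))
    (hr : ∀ a b, Γ.Adj a b → r a = r b ∨ Δ.Adj (r a) (r b)) {a b : W} (h : Δ.Reachable a b) :
    Γ.Reachable (i a) (i b) ∧ Δ.dist a b ≤ Γ.dist (i a) (i b) := by
  have hreach : Γ.Reachable (i a) (i b) := by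
    obtain ⟨w⟩ := h
    obtain ⟨w', -⟩ := exists_walk_length_le_of_adj_or_eq hi w
    exact ⟨w'⟩
  refine ⟨hreach, ?_⟩
  obtain ⟨w, hw⟩ := hreach.exists_walk_length_eq_dist
  obtain ⟨w', hw'⟩ := exists_walk_length_le_of_adj_or_eq hr w
  calc Δ.dist a b = Δ.dist (r (i a)) (r (i b)) := by rw [hri, hri]
    _ ≤ Γ.dist (i a) (i b) := (SimpleGraph.dist_le w').trans (hw'.trans hw.le)

end Graphs

/-! ### Commensurability up to powers of a prime -/

section Commensurable

variable {G H : Type*} [Group G] [Group H] {p : ℕ}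

/-- Two subgroups are `p`-commensurable if their intersection has `p`-power index in both.
This is the reflexive closure of adjacency in the `p`-local commensurability graph. -/
def PCommensurable (p : ℕ) (A B : Subgroup G) : Prop :=
  ∃ k, A.relIndex B * B.relIndex A = p ^ k

theorem PCommensurable.of_dvd (hp : p.Prime) {A B : Subgroup G} {A' B' : Subgroup H}
    (h : PCommensurable p A B) (h₁ : A'.relIndex B' ∣ A.relIndex B)
    (h₂ : B'.relIndex A' ∣ B.relIndex A) : PCommensurable p A' B' := by
  obtain ⟨k, hk⟩ := h
  obtain ⟨j, -, hj⟩ := (Nat.dvd_prime_pow hp).1 (hk ▸ mul_dvd_mul h₁ h₂)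
  exact ⟨j, hj⟩

theorem PCommensurable.exists_eq_pow (hp : p.Prime) {A B : Subgroup G}
    (h : PCommensurable p A B) : ∃ s t, B.relIndex A = p ^ s ∧ A.relIndex B = p ^ t := by
  obtain ⟨k, hk⟩ := h
  obtain ⟨s, -, hs⟩ := (Nat.dvd_prime_pow hp).1 (Dvd.intro_left _ hk)
  obtain ⟨t, -, ht⟩ := (Nat.dvd_prime_pow hp).1 (Dvd.intro _ hk)
  exact ⟨s, t, hs, ht⟩

theorem pLocalCommensurabilityGraph_adj_iff {G : Type u} [Group G] {A B : FiniteIndexSubgroup G} :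
    (pLocalCommensurabilityGraph p G).Adj A B ↔ A ≠ B ∧ PCommensurable p A.1 B.1 := by
  simp only [pLocalCommensurabilityGraph, PCommensurable, Subgroup.inf_relIndex_left,
    Subgroup.inf_relIndex_right, mul_comm]

theorem eq_or_adj_of_pCommensurable {G : Type u} [Group G] {A B : FiniteIndexSubgroup G}
    (h : PCommensurable p A.1 B.1) : A = B ∨ (pLocalCommensurabilityGraph p G).Adj A B := by
  by_cases hAB : A = B
  · exact .inl hAB
  · exact .inr (pLocalCommensurabilityGraph_adj_iff.2 ⟨hAB, h⟩)

/-- Up to powers of `p`, the index is constant on connected components. -/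
theorem exists_index_mul_pow_eq_of_reachable (hp : p.Prime) {G : Type u} [Group G]
    {A B : FiniteIndexSubgroup G} (h : (pLocalCommensurabilityGraph p G).Reachable A B) :
    ∃ i j, A.1.index * p ^ i = B.1.index * p ^ j := by
  obtain ⟨w⟩ := h
  induction w with
  | nil => exact ⟨0, 0, rfl⟩
  | @cons A B C hAB _ ih =>
    obtain ⟨i, j, hij⟩ := ih
    obtain ⟨s, t, hs, ht⟩ := (pLocalCommensurabilityGraph_adj_iff.1 hAB).2.exists_eq_pow hp
    have h₁ := Subgroup.relIndex_mul_index (inf_le_left : A.1 ⊓ B.1 ≤ A.1)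
    have h₂ := Subgroup.relIndex_mul_index (inf_le_right : A.1 ⊓ B.1 ≤ B.1)
    rw [Subgroup.inf_relIndex_left, hs] at h₁
    rw [Subgroup.inf_relIndex_right, ht] at h₂
    refine ⟨s + i, t + j, ?_⟩
    calc A.1.index * p ^ (s + i) = (p ^ s * A.1.index) * p ^ i := by ring
      _ = p ^ t * (B.1.index * p ^ i) := by rw [h₁, ← h₂]; ring
      _ = C.1.index * p ^ (t + j) := by rw [hij]; ring

theorem relIndex_map_dvd (f : G →* H) (A B : Subgroup G) :
    (B.map f).relIndex (A.map f) ∣ B.relIndex A := by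
  rw [← Subgroup.relIndex_comap]
  exact Subgroup.relIndex_dvd_of_le_left _ (Subgroup.le_comap_map f B)

/-- With `L` normal, the index of `C ⊓ L` in `L` equals that of `C` in `C ⊔ L`. -/
theorem relIndex_dvd_index_of_right_normal (C L : Subgroup G) [L.Normal] [L.FiniteIndex] :
    C.relIndex L ∣ C.index := by
  have h₁ := Subgroup.relIndex_mul_index (inf_le_left : C ⊓ L ≤ C)
  have h₂ := Subgroup.relIndex_mul_relIndex _ _ _ (inf_le_right : C ⊓ L ≤ L)
    (le_sup_right : L ≤ C ⊔ L)
  have h₃ := Subgroup.relIndex_mul_relIndex _ _ _ (inf_le_left : C ⊓ L ≤ C)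
    (le_sup_left : C ≤ C ⊔ L)
  rw [Subgroup.inf_relIndex_left] at h₃
  rw [Subgroup.relIndex_sup_right, Subgroup.inf_relIndex_right, ← h₃, mul_comm] at h₂
  have h₀ : L.relIndex C ≠ 0 :=
    fun h ↦ Subgroup.FiniteIndex.index_ne_zero (Subgroup.index_eq_zero_of_relIndex_eq_zero h)
  rw [Nat.eq_of_mul_eq_mul_left (Nat.pos_of_ne_zero h₀) h₂]
  exact Subgroup.relIndex_dvd_index_of_le le_sup_left

theorem relIndex_subgroupOf_normal_dvd (K A B : Subgroup G) [K.Normal] [K.FiniteIndex] :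
    (B.subgroupOf K).relIndex (A.subgroupOf K) ∣ B.relIndex A := by
  have h := relIndex_dvd_index_of_right_normal (B.subgroupOf A) (K.subgroupOf A)
  have key : ∀ A K : Subgroup G,
      (B.subgroupOf A).relIndex (K.subgroupOf A) = B.relIndex (K ⊓ A) := by
    intro A K
    rw [Subgroup.subgroupOf, Subgroup.relIndex_comap, Subgroup.subgroupOf_map_subtype]
  rw [key] at h ⊢
  rwa [inf_comm]

end Commensurable

/-! ### Distant pairs and their transfer -/

section DistantPair

/-- The graph `Γ_p(G)` has a component containing a subgroup of index `c` and, at finite distance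
greater than `N` from it, another subgroup. -/
def HasDistantPair (p N c : ℕ) (G : Type u) [Group G] : Prop :=
  ∃ A B : FiniteIndexSubgroup G, A.1.index = c ∧
    (pLocalCommensurabilityGraph p G).Reachable A B ∧
    N < (pLocalCommensurabilityGraph p G).dist A B

variable {p N c : ℕ}

/-- Intersecting with a normal subgroup `K` of finite index is a retraction of `Γ_p(G)` onto
`Γ_p(K)`, because `[A ∩ K : A ∩ B ∩ K]` divides `[A : A ∩ B]`. -/
theorem HasDistantPair.of_normal (hp : p.Prime) {G : Type u} [Group G] (K : Subgroup G) [K.Normal]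
    [K.FiniteIndex] (h : HasDistantPair p N c K) : HasDistantPair p N (c * K.index) G := by
  obtain ⟨A, B, hA, hAB, hN⟩ := h
  let i : FiniteIndexSubgroup K → FiniteIndexSubgroup G := fun C ↦ ⟨C.1.map K.subtype, ⟨by
    rw [Subgroup.index_map_subtype]
    exact mul_ne_zero C.2.index_ne_zero Subgroup.FiniteIndex.index_ne_zero⟩⟩
  let r : FiniteIndexSubgroup G → FiniteIndexSubgroup K := fun C ↦
    haveI := C.2
    ⟨C.1.subgroupOf K, inferInstance⟩
  have := reachable_and_dist_le_of_retract (Γ := pLocalCommensurabilityGraph p G)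
    (Δ := pLocalCommensurabilityGraph p K) (i := i) (r := r)
    (fun C ↦ Subtype.ext (Subgroup.comap_map_eq_self_of_injective K.subtype_injective _))
    (fun C D h ↦ eq_or_adj_of_pCommensurable
      ((pLocalCommensurabilityGraph_adj_iff.1 h).2.of_dvd hp
        (relIndex_map_dvd _ _ _) (relIndex_map_dvd _ _ _)))
    (fun C D h ↦ eq_or_adj_of_pCommensurable
      ((pLocalCommensurabilityGraph_adj_iff.1 h).2.of_dvd hp
        (relIndex_subgroupOf_normal_dvd _ _ _) (relIndex_subgroupOf_normal_dvd _ _ _))) hAB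
  exact ⟨i A, i B, by rw [← hA, Subgroup.index_map_subtype], this.1, hN.trans_le this.2⟩

/-- Taking images under a surjective homomorphism is a retraction of graphs, with section given by
preimages. -/
theorem HasDistantPair.of_surjective (hp : p.Prime) {G H : Type*} [Group G] [Group H] (f : G →* H)
    (hf : Function.Surjective f) (h : HasDistantPair p N c H) : HasDistantPair p N c G := by
  obtain ⟨A, B, hA, hAB, hN⟩ := h
  let i : FiniteIndexSubgroup H → FiniteIndexSubgroup G := fun C ↦ ⟨C.1.comap f, ⟨by
    rw [Subgroup.index_comap_of_surjective _ hf]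
    exact C.2.index_ne_zero⟩⟩
  let r : FiniteIndexSubgroup G → FiniteIndexSubgroup H := fun C ↦ ⟨C.1.map f,
    ⟨ne_zero_of_dvd_ne_zero C.2.index_ne_zero (Subgroup.index_map_dvd _ hf)⟩⟩
  have key : ∀ C D : Subgroup H, (C.comap f).relIndex (D.comap f) = C.relIndex D := by
    intro C D
    rw [Subgroup.relIndex_comap, Subgroup.map_comap_eq_self_of_surjective hf]
  have := reachable_and_dist_le_of_retract (Γ := pLocalCommensurabilityGraph p G)
    (Δ := pLocalCommensurabilityGraph p H) (i := i) (r := r)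
    (fun C ↦ Subtype.ext (Subgroup.map_comap_eq_self_of_surjective hf _))
    (fun C D h ↦ eq_or_adj_of_pCommensurable
      ((pLocalCommensurabilityGraph_adj_iff.1 h).2.of_dvd hp (key _ _).dvd (key _ _).dvd))
    (fun C D h ↦ eq_or_adj_of_pCommensurable
      ((pLocalCommensurabilityGraph_adj_iff.1 h).2.of_dvd hp
        (relIndex_map_dvd _ _ _) (relIndex_map_dvd _ _ _))) hAB
  exact ⟨i A, i B, by rw [← hA]; exact Subgroup.index_comap_of_surjective _ hf, this.1,
    hN.trans_le this.2⟩

end DistantPair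

/-! ### Free groups -/

section FreeGroups

variable {p N c : ℕ}

theorem nontrivial_of_freeGroup_not_isCyclic {α : Type*} (h : ¬ IsCyclic (FreeGroup α)) :
    Nontrivial α := by
  by_contra hα
  rw [not_nontrivial_iff_subsingleton] at hα
  refine h ?_
  rcases isEmpty_or_nonempty α with hα' | ⟨⟨x⟩⟩
  · exact isCyclic_of_subsingleton
  · have : Unique α := uniqueOfSubsingleton x
    exact (FreeGroup.mulEquivIntOfUnique (α := α)).isCyclic.2 inferInstance

/-- Powers of distinct free generators do not commute, as is seen by sending the generators to
`z ↦ 2z` and `z ↦ z + 1`. -/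
theorem freeGroup_pow_mul_pow_ne {α : Type*} {x y : α} (hxy : x ≠ y) {m n : ℕ} (hm : m ≠ 0)
    (hn : n ≠ 0) : FreeGroup.of x ^ m * FreeGroup.of y ^ n ≠
      FreeGroup.of y ^ n * FreeGroup.of x ^ m := by
  classical
  intro h
  let φ : FreeGroup α →* Equiv.Perm ℚ := FreeGroup.lift fun z ↦
    if z = x then Equiv.mulLeft₀ 2 two_ne_zero else Equiv.addRight 1
  have hx : ∀ (m : ℕ) (q : ℚ), φ (FreeGroup.of x ^ m) q = 2 ^ m * q := by
    intro m
    induction m with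
    | zero => simp
    | succ m ih =>
      intro q
      rw [pow_succ, map_mul, Equiv.Perm.mul_apply, ih]
      simp [φ]; ring
  have hy : ∀ (n : ℕ) (q : ℚ), φ (FreeGroup.of y ^ n) q = q + n := by
    intro n
    induction n with
    | zero => simp
    | succ n ih =>
      intro q
      rw [pow_succ, map_mul, Equiv.Perm.mul_apply, ih]
      simp [φ, hxy.symm]; ring
  have h₁ := DFunLike.congr_fun (congrArg φ h) (0 : ℚ)
  rw [map_mul, map_mul, Equiv.Perm.mul_apply, Equiv.Perm.mul_apply, hx, hx, hy, hy] at h₁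
  have h₂ : (2 : ℚ) ^ m = 1 := by
    have : (n : ℚ) ≠ 0 := by exact_mod_cast hn
    apply mul_right_cancel₀ this
    linarith
  exact (one_lt_pow₀ (by norm_num : (1 : ℚ) < 2) hm).ne' h₂

/-- A subgroup of finite index in a free group of rank at least two is free of rank at least
two. -/
theorem exists_mulEquiv_freeGroup_nontrivial {α : Type u} [Nontrivial α]
    (K : Subgroup (FreeGroup α)) [K.FiniteIndex] :
    ∃ β : Type u, Nontrivial β ∧ Nonempty (K ≃* FreeGroup β) := by
  let e := IsFreeGroup.toFreeGroup K
  refine ⟨_, nontrivial_of_freeGroup_not_isCyclic fun _ ↦ ?_, ⟨e⟩⟩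
  obtain ⟨x, y, hxy⟩ := exists_pair_ne α
  obtain ⟨m, hm, -, hmx⟩ := K.exists_pow_mem_of_index_ne_zero Subgroup.FiniteIndex.index_ne_zero
    (FreeGroup.of x)
  obtain ⟨n, hn, -, hny⟩ := K.exists_pow_mem_of_index_ne_zero Subgroup.FiniteIndex.index_ne_zero
    (FreeGroup.of y)
  have h : e (⟨_, hmx⟩ * ⟨_, hny⟩) = e (⟨_, hny⟩ * ⟨_, hmx⟩) := by
    rw [map_mul, map_mul]
    exact IsCyclic.isMulCommutative.is_comm.comm _ _
  exact freeGroup_pow_mul_pow_ne hxy hm.ne' hn.ne' (congrArg Subtype.val (e.injective h))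

open RegularWreathProduct in
/-- The wreath product `Q ≀ Z` contains the subgroup of elements with trivial image in `Z`, which
evaluates to `Q` at the identity of `Z`. -/
def wreathEval {F Q Z : Type*} [Group F] [Group Q] [Group Z] (φ : F →* Q ≀ᵣ Z) :
    (rightHom.comp φ).ker →* Q where
  toFun w := (φ w).left 1
  map_one' := by simp
  map_mul' := by
    rintro ⟨a, ha⟩ ⟨b, hb⟩
    have ha' : (φ a).right = 1 := ha
    simp [ha']

open RegularWreathProduct in
/-- Let `x` map to a generator `t` of `ℤ/n` and `y` to a family listing the elements of `Q`. The
conjugates of `y` by powers of `x` then evaluate to all elements of `Q`, so that the kernel of the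
map to `ℤ/n` surjects onto `Q`. -/
theorem exists_normal_index_eq_surjective {β : Type*} [Nontrivial β] (Q : Type*) [Group Q]
    [Finite Q] {n : ℕ} [NeZero n] (hn : Nat.card Q ≤ n) :
    ∃ K : Subgroup (FreeGroup β), K.Normal ∧ K.index = n ∧
      ∃ f : K →* Q, Function.Surjective f := by
  classical
  obtain ⟨x, y, hxy⟩ := exists_pair_ne β
  let Z := Multiplicative (ZMod n)
  have hcard : Nat.card Z = n := by simp [Z]
  obtain ⟨q, hq⟩ : ∃ q : Z → Q, Function.Surjective q := by
    have := Fintype.ofFinite Q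
    obtain ⟨ι⟩ := Function.Embedding.nonempty_of_card_le (α := Q) (β := Z) (by
      rwa [← Nat.card_eq_fintype_card, ← Nat.card_eq_fintype_card, hcard])
    exact ⟨_, Function.invFun_surjective ι.injective⟩
  let φ : FreeGroup β →* Q ≀ᵣ Z := FreeGroup.lift fun z ↦
    if z = x then inl (Multiplicative.ofAdd 1) else if z = y then ⟨q, 1⟩ else 1
  have hx : ∀ k : ℕ, φ (FreeGroup.of x ^ k) = inl (Multiplicative.ofAdd (k : ZMod n)) := by
    intro k
    rw [map_pow]
    simp only [φ, FreeGroup.lift_apply_of, if_true]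
    rw [← map_pow, ← ofAdd_nsmul, nsmul_one]
  have hy : φ (FreeGroup.of y) = ⟨q, 1⟩ := by simp [φ, hxy.symm]
  have hsurj : Function.Surjective (rightHom.comp φ) := by
    intro z
    refine ⟨FreeGroup.of x ^ (Multiplicative.toAdd z).val, ?_⟩
    rw [MonoidHom.comp_apply, hx, fun_id, ZMod.natCast_zmod_val]
    rfl
  refine ⟨(rightHom.comp φ).ker, inferInstance, ?_, wreathEval φ, fun g ↦ ?_⟩
  · rw [Subgroup.index_ker, MonoidHom.range_eq_top.2 hsurj, Subgroup.card_top, hcard]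
  · obtain ⟨z, rfl⟩ := hq g
    have hz := hx (Multiplicative.toAdd z).val
    rw [ZMod.natCast_zmod_val] at hz
    set w := FreeGroup.of x ^ (Multiplicative.toAdd z).val
    have hw : φ (w⁻¹ * FreeGroup.of y * w) =
        (inl z)⁻¹ * ⟨q, 1⟩ * inl z := by
      rw [map_mul, map_mul, map_inv, hz, hy]; rfl
    refine ⟨⟨w⁻¹ * FreeGroup.of y * w, ?_⟩, ?_⟩
    · rw [MonoidHom.mem_ker, MonoidHom.comp_apply, hw]
      simp
    · change (φ _).left 1 = _
      rw [hw]
      simp only [RegularWreathProduct.mul_left, RegularWreathProduct.inv_left,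
        RegularWreathProduct.mul_right, RegularWreathProduct.inv_right, left_inl, right_inl,
        Pi.mul_apply, Pi.one_apply, inv_one, one_mul, mul_one]
      exact congrArg q (inv_inv z)

theorem HasDistantPair.freeGroup (hp : p.Prime) {β Q : Type*} [Nontrivial β] [Group Q] [Finite Q]
    (h : HasDistantPair p N c Q) {n : ℕ} (hn : Nat.card Q ≤ n) :
    HasDistantPair p N (c * n) (FreeGroup β) := by
  have : NeZero n := ⟨(Nat.card_pos.trans_le hn).ne'⟩
  obtain ⟨K, hK, rfl, f, hf⟩ := exists_normal_index_eq_surjective (β := β) Q hn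
  have : K.FiniteIndex := ⟨NeZero.ne _⟩
  exact (h.of_surjective hp f hf).of_normal hp K

/-- A large group has a normal subgroup of finite index that surjects onto a free group of rank at
least two: pass to the normal core, and use that subgroups of free groups are free. -/
theorem IsLargeGroup.exists_normal_surjective {G : Type u} [Group G] (hG : IsLargeGroup G) :
    ∃ K : Subgroup G, K.Normal ∧ K.FiniteIndex ∧ ∃ β : Type u, Nontrivial β ∧
      ∃ f : K →* FreeGroup β, Function.Surjective f := by
  obtain ⟨H, hH, α, f, hf, hα⟩ := hG
  have := nontrivial_of_freeGroup_not_isCyclic hα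
  let g : H.normalCore →* FreeGroup α := f.comp (Subgroup.inclusion H.normalCore_le)
  have hg : g.range = (H.normalCore.subgroupOf H).map f := by
    rw [MonoidHom.range_comp, Subgroup.inclusion_range]
  have : g.range.FiniteIndex := by
    rw [hg]
    exact ⟨ne_zero_of_dvd_ne_zero Subgroup.FiniteIndex.index_ne_zero (Subgroup.index_map_dvd _ hf)⟩
  obtain ⟨β, hβ, ⟨e⟩⟩ := exists_mulEquiv_freeGroup_nontrivial g.range
  exact ⟨H.normalCore, inferInstance, inferInstance, β, hβ, e.toMonoidHom.comp g.rangeRestrict,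
    e.surjective.comp g.rangeRestrict_surjective⟩

end FreeGroups

/-! ### Geodesics in large groups -/

theorem exists_geodesics_of_hasDistantPair {G : Type u} [Group G] {p N c m : ℕ} (hp : p.Prime)
    (h : ∀ n, m ≤ n → HasDistantPair p N (c * n) G) :
    ∃ S : Set (GraphGeodesic (pLocalCommensurabilityGraph p G)),
      S.Infinite ∧
      (∀ γ ∈ S, ∀ γ' ∈ S, γ ≠ γ' → γ.component ≠ γ'.component) ∧
      ∀ γ ∈ S, N < γ.length := by
  -- Indices congruent to `1` modulo `p`, so that no power of `p` can relate two of them.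
  let n : ℕ → ℕ := fun t ↦ p * (t + m) + 1
  have hn : ∀ t, (n t).Coprime p := fun t ↦ by simp [n]
  have hexists : ∀ t, ∃ γ : GraphGeodesic (pLocalCommensurabilityGraph p G),
      γ.source.1.index = c * n t ∧ N < γ.length := by
    intro t
    obtain ⟨A, B, hA, hAB, hN⟩ := h (n t) (by
      have := Nat.le_mul_of_pos_left (t + m) hp.pos
      simp only [n]; omega)
    obtain ⟨w, hw⟩ := hAB.exists_walk_length_eq_dist
    exact ⟨⟨A, B, w, hw⟩, hA, hN.trans_eq hw.symm⟩
  choose γ hγ hγN using hexists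
  have hinj : ∀ s t, (γ s).component = (γ t).component → s = t := by
    intro s t hst
    obtain ⟨i, j, hij⟩ := exists_index_mul_pow_eq_of_reachable hp
      (SimpleGraph.ConnectedComponent.exact hst)
    rw [hγ, hγ] at hij
    have hc : c ≠ 0 := by
      rintro rfl
      exact (γ s).source.2.index_ne_zero (by rw [hγ, zero_mul])
    have hij' : n s * p ^ i = n t * p ^ j :=
      Nat.eq_of_mul_eq_mul_left (Nat.pos_of_ne_zero hc) (by simpa only [mul_assoc] using hij)
    have : n s = n t := Nat.dvd_antisymm
      (((hn s).pow_right j).dvd_of_dvd_mul_right (hij' ▸ Dvd.intro _ rfl))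
      (((hn t).pow_right i).dvd_of_dvd_mul_right (hij' ▸ Dvd.intro _ rfl))
    simpa [n, hp.ne_zero] using this
  refine ⟨Set.range γ, Set.infinite_range_of_injective fun s t hst ↦ hinj s t (by rw [hst]), ?_, ?_⟩
  · rintro _ ⟨s, rfl⟩ _ ⟨t, rfl⟩ hne hst
    exact hne (by rw [hinj s t hst])
  · rintro _ ⟨t, rfl⟩
    exact hγN t

/-! ### Functions differing by a constant almost everywhere -/

section AlmostParallel

variable {X M : Type*} [AddCommGroup M]

/-- The functions `f` and `g` differ by a constant outside a set of at most `n` points. -/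
def AlmostParallel (n : ℕ) (f g : X → M) : Prop :=
  ∃ (c : M) (s : Finset X), s.card ≤ n ∧ ∀ x ∉ s, g x = f x + c

theorem AlmostParallel.trans {m n : ℕ} {f g h : X → M}
    (hfg : AlmostParallel m f g) (hgh : AlmostParallel n g h) : AlmostParallel (m + n) f h := by
  classical
  obtain ⟨c, s, hs, hc⟩ := hfg
  obtain ⟨d, t, ht, hd⟩ := hgh
  refine ⟨c + d, s ∪ t, (Finset.card_union_le s t).trans (add_le_add hs ht), fun x hx ↦ ?_⟩
  rw [Finset.mem_union, not_or] at hx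
  rw [hd x hx.2, hc x hx.1, add_assoc]

/-- The distance from the zero function to an injective function is as large as possible. -/
theorem card_le_of_almostParallel_zero [Finite X] {n : ℕ} {g : X → M}
    (hg : Function.Injective g) (h : AlmostParallel n 0 g) : Nat.card X ≤ n + 1 := by
  classical
  have := Fintype.ofFinite X
  obtain ⟨c, s, hs, hc⟩ := h
  have h₁ : sᶜ.card ≤ 1 := Finset.card_le_one.2 fun x hx y hy ↦ hg (by
    rw [hc x (by simpa using hx), hc y (by simpa using hy)]; rfl)
  rw [Finset.card_compl] at h₁
  rw [Nat.card_eq_fintype_card]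
  omega

end AlmostParallel

/-! ### Twisted affine groups -/

/-- The group of transformations `f ↦ (x ↦ f (a * x + b) + v x)` of the functions `K → M`, which
is the wreath product of `M` with the affine group of the line `K`. -/
@[ext]
structure TwistedAffine (K M : Type*) [Field K] where
  /-- the linear part of the affine substitution -/
  a : Kˣ
  /-- the translation part of the affine substitution -/
  b : K
  /-- the function that is added -/
  v : K → M

namespace TwistedAffine

variable {K M : Type*} [Field K]

section Group

variable [AddCommGroup M]

/-- Composition of transformations, the right factor acting first. -/
instance : Mul (TwistedAffine K M) :=
  ⟨fun q r ↦ ⟨r.a * q.a, r.a * q.b + r.b, fun x ↦ r.v (q.a * x + q.b) + q.v x⟩⟩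

instance : One (TwistedAffine K M) := ⟨⟨1, 0, 0⟩⟩

instance : Inv (TwistedAffine K M) :=
  ⟨fun q ↦ ⟨q.a⁻¹, -(q.a⁻¹ * q.b), fun x ↦ -q.v (q.a⁻¹ * x - q.a⁻¹ * q.b)⟩⟩

theorem mul_a (q r : TwistedAffine K M) : (q * r).a = r.a * q.a := rfl

theorem mul_b (q r : TwistedAffine K M) : (q * r).b = r.a * q.b + r.b := rfl

theorem mul_v (q r : TwistedAffine K M) (x : K) :
    (q * r).v x = r.v (q.a * x + q.b) + q.v x := rfl

theorem one_a : (1 : TwistedAffine K M).a = 1 := rfl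

theorem one_b : (1 : TwistedAffine K M).b = 0 := rfl

theorem one_v : (1 : TwistedAffine K M).v = 0 := rfl

theorem inv_a (q : TwistedAffine K M) : q⁻¹.a = q.a⁻¹ := rfl

theorem inv_b (q : TwistedAffine K M) : q⁻¹.b = -(q.a⁻¹ * q.b) := rfl

theorem inv_v (q : TwistedAffine K M) (x : K) :
    q⁻¹.v x = -q.v (q.a⁻¹ * x - q.a⁻¹ * q.b) := rfl

instance : Group (TwistedAffine K M) :=
  Group.ofLeftAxioms
    (fun q r s ↦ by
      ext x
      · simp [mul_a, mul_assoc]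
      · simp only [mul_a, mul_b, Units.val_mul]; ring
      · simp only [mul_a, mul_b, mul_v, Units.val_mul, mul_add, add_assoc, mul_assoc])
    (fun q ↦ by
      ext x
      · simp [mul_a, one_a]
      · simp [mul_b, one_b]
      · simp [mul_v, one_v, one_a, one_b])
    (fun q ↦ by
      ext x
      · simp [mul_a, inv_a, one_a]
      · simp [mul_b, inv_b, one_b]
      · simp [mul_v, inv_v, inv_a, inv_b, one_v, sub_eq_add_neg])

/-- The defining action on functions. It is not pointwise: it also moves the argument. -/
instance : MulAction (TwistedAffine K M) (K → M) where
  smul q f x := f (q.a * x + q.b) + q.v x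
  one_smul f := by
    funext x
    change f ((1 : Kˣ) * x + 0) + (0 : K → M) x = f x
    simp
  mul_smul q r f := by
    funext x
    change f (((r.a * q.a : Kˣ) : K) * x + (r.a * q.b + r.b)) + (r.v (q.a * x + q.b) + q.v x) =
      f (r.a * (q.a * x + q.b) + r.b) + r.v (q.a * x + q.b) + q.v x
    rw [Units.val_mul, ← add_assoc, ← add_assoc, mul_add, mul_assoc]

theorem smul_apply (q : TwistedAffine K M) (f : K → M) (x : K) :
    (q • f) x = f (q.a * x + q.b) + q.v x := rfl

/-- The linear part, as a homomorphism. -/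
def linearPart : TwistedAffine K M →* Kˣ where
  toFun := a
  map_one' := rfl
  map_mul' _ _ := mul_comm _ _

/-- The data of a transformation, as a triple. -/
def equivProd : TwistedAffine K M ≃ Kˣ × K × (K → M) where
  toFun q := (q.a, q.b, q.v)
  invFun t := ⟨t.1, t.2.1, t.2.2⟩
  left_inv _ := rfl
  right_inv _ := rfl

instance [Finite K] [Finite M] : Finite (TwistedAffine K M) := Finite.of_equiv _ equivProd.symm

theorem card_ker_linearPart [Finite K] :
    Nat.card (linearPart : TwistedAffine K M →* Kˣ).ker =
      Nat.card K * Nat.card M ^ Nat.card K := by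
  have e : (linearPart : TwistedAffine K M →* Kˣ).ker ≃ K × (K → M) :=
    { toFun q := (q.1.b, q.1.v)
      invFun t := ⟨⟨1, t.1, t.2⟩, rfl⟩
      left_inv q := by
        have : q.1.a = 1 := q.2
        ext x <;> simp [this]
      right_inv _ := rfl }
  rw [Nat.card_congr e, Nat.card_prod, Nat.card_fun]

open MulAction

/-- The affine substitution `x ↦ a * x + b` can be prescribed for a transformation fixing `f`, and
determines it, since then `v x = f x - f (a * x + b)`. -/
def stabilizerEquiv (f : K → M) : stabilizer (TwistedAffine K M) f ≃ Kˣ × K where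
  toFun q := (q.1.a, q.1.b)
  invFun t := ⟨⟨t.1, t.2, fun x ↦ f x - f (t.1 * x + t.2)⟩, by
    rw [mem_stabilizer_iff]
    funext x
    simp [smul_apply]⟩
  left_inv q := by
    have h := mem_stabilizer_iff.1 q.2
    ext x
    · rfl
    · rfl
    · change f x - f (q.1.a * x + q.1.b) = q.1.v x
      rw [sub_eq_iff_eq_add', ← smul_apply, h]
  right_inv _ := rfl

theorem card_stabilizer (f : K → M) :
    Nat.card (stabilizer (TwistedAffine K M) f) = Nat.card Kˣ * Nat.card K := by
  rw [Nat.card_congr (stabilizerEquiv f), Nat.card_prod]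

/-- If `f` and `g` differ only at `x₀`, then the dilations with centre `x₀` lift to transformations
that fix both. -/
theorem map_linearPart_stabilizer_inf_eq_top {f g : K → M} {x₀ : K}
    (h : ∀ x, x ≠ x₀ → f x = g x) :
    (stabilizer (TwistedAffine K M) f ⊓ stabilizer (TwistedAffine K M) g).map linearPart = ⊤ := by
  rw [eq_top_iff]
  rintro a -
  refine ⟨⟨a, x₀ - a * x₀, fun x ↦ f x - f (a * x + (x₀ - a * x₀))⟩, ⟨?_, ?_⟩, rfl⟩
  · refine mem_stabilizer_iff.2 (funext fun x ↦ ?_)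
    simp [smul_apply]
  · refine mem_stabilizer_iff.2 (funext fun x ↦ ?_)
    rw [smul_apply]
    dsimp only
    by_cases hx : x = x₀
    · subst hx; simp
    · have hx' : a * x + (x₀ - a * x₀) ≠ x₀ := by
        intro h'
        have : (a : K) * (x - x₀) = 0 := by linear_combination h'
        simp [sub_eq_zero, hx] at this
      rw [h _ hx, h _ hx']
      abel

theorem pCommensurable_stabilizer [Finite K] {p k : ℕ} (hp : p.Prime) (hK : Nat.card K = p ^ k)
    {f g : K → M} {x₀ : K} (h : ∀ x, x ≠ x₀ → f x = g x) :
    PCommensurable p (stabilizer (TwistedAffine K M) f) (stabilizer (TwistedAffine K M) g) := by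
  have key : ∀ f g : K → M, (∀ x, x ≠ x₀ → f x = g x) →
      ∃ i, (stabilizer (TwistedAffine K M) f).relIndex (stabilizer (TwistedAffine K M) g) =
        p ^ i := by
    intro f g h
    have hd := Subgroup.card_map_dvd (linearPart : TwistedAffine K M →* Kˣ)
      (H := stabilizer (TwistedAffine K M) f ⊓ stabilizer (TwistedAffine K M) g)
    rw [map_linearPart_stabilizer_inf_eq_top h, Subgroup.card_top] at hd
    obtain ⟨d, hd⟩ := hd
    have hmul := Subgroup.relIndex_mul_relIndex ⊥ _ _ bot_le (inf_le_right :
      stabilizer (TwistedAffine K M) f ⊓ stabilizer (TwistedAffine K M) g ≤ _)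
    rw [Subgroup.relIndex_bot_left, Subgroup.relIndex_bot_left, Subgroup.inf_relIndex_right,
      card_stabilizer, hd, mul_assoc, hK] at hmul
    have := Nat.eq_of_mul_eq_mul_left Nat.card_pos hmul
    obtain ⟨i, -, hi⟩ := (Nat.dvd_prime_pow hp).1 (this ▸ Dvd.intro_left _ rfl)
    exact ⟨i, hi⟩
  obtain ⟨i, hi⟩ := key f g h
  obtain ⟨j, hj⟩ := key g f fun x hx ↦ (h x hx).symm
  exact ⟨i + j, by rw [hi, hj, pow_add]⟩

/-- Changing one value at a time connects the stabilizers of all functions. -/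
theorem reachable_stabilizer [Finite K] [Finite M] {p k : ℕ} (hp : p.Prime)
    (hK : Nat.card K = p ^ k) (f g : K → M) :
    (pLocalCommensurabilityGraph p (TwistedAffine K M)).Reachable
      ⟨stabilizer _ f, inferInstance⟩ ⟨stabilizer _ g, inferInstance⟩ := by
  classical
  have := Fintype.ofFinite K
  suffices h : ∀ s : Finset K, (pLocalCommensurabilityGraph p (TwistedAffine K M)).Reachable
      ⟨stabilizer _ f, inferInstance⟩ ⟨stabilizer _ (s.piecewise g f), inferInstance⟩ by
    simpa using h Finset.univ
  intro s
  induction s using Finset.induction_on with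
  | empty => simp
  | insert x₀ s _ ih =>
    refine ih.trans ?_
    rcases eq_or_adj_of_pCommensurable (p := p)
      (A := ⟨stabilizer (TwistedAffine K M) (s.piecewise g f), inferInstance⟩)
      (B := ⟨stabilizer (TwistedAffine K M) ((insert x₀ s).piecewise g f), inferInstance⟩)
      (pCommensurable_stabilizer hp hK (x₀ := x₀) fun x hx ↦ by simp [Finset.piecewise, hx])
      with h | h
    · rw [h]
    · exact h.reachable

end Group

/-! ### Distances between stabilizers -/

section Distance

open MulAction

/-- An affine map of a finite field whose linear part generates the multiplicative group has a
fixed point and permutes the other points transitively. -/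
theorem almostParallel_of_smul_eq [AddCommGroup M] [Finite K] (hK : 2 < Nat.card K)
    {q : TwistedAffine K M} (hq : ∀ u : Kˣ, u ∈ Subgroup.zpowers q.a) {f g : K → M}
    (hf : q • f = f) (hg : q • g = g) : AlmostParallel 1 f g := by
  have ha : (q.a : K) ≠ 1 := by
    intro h
    rw [Units.val_eq_one] at h
    have : Subsingleton Kˣ := ⟨fun u v ↦ by
      have hu := hq u
      have hv := hq v
      rw [h, Subgroup.zpowers_one_eq_bot, Subgroup.mem_bot] at hu hv
      rw [hu, hv]⟩
    have h₁ := Nat.card_units K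
    rw [Nat.card_of_subsingleton 1] at h₁
    omega
  set x₀ : K := q.b / (1 - q.a) with hx₀
  have hfix : (q.a : K) * x₀ + q.b = x₀ := by
    have : (1 : K) - q.a ≠ 0 := sub_ne_zero.2 ha.symm
    rw [hx₀]; field_simp; ring
  have hstep : ∀ y : K, (g - f) (x₀ + q.a * y) = (g - f) (x₀ + y) := by
    intro y
    have h₁ := congrFun hf (x₀ + y)
    have h₂ := congrFun hg (x₀ + y)
    have h₃ : (q.a : K) * (x₀ + y) + q.b = x₀ + q.a * y := by linear_combination hfix
    rw [smul_apply, h₃] at h₁ h₂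
    rw [Pi.sub_apply, Pi.sub_apply, ← h₁, ← h₂]
    abel
  have hpow : ∀ n : ℕ, (g - f) (x₀ + (q.a ^ n : Kˣ)) = (g - f) (x₀ + 1) := by
    intro n
    induction n with
    | zero => simp
    | succ n ih => rw [pow_succ', Units.val_mul, hstep, ih]
  refine ⟨(g - f) (x₀ + 1), {x₀}, by simp, fun x hx ↦ ?_⟩
  rw [Finset.mem_singleton] at hx
  obtain ⟨n, hn⟩ := mem_powers_iff_mem_zpowers.2 (hq (Units.mk0 (x - x₀) (sub_ne_zero.2 hx)))
  have h := hpow n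
  simp only at hn
  rw [hn, Units.val_mk0, add_sub_cancel] at h
  rw [← h, Pi.sub_apply, add_sub_cancel]

variable {ℓ : ℕ} [Fact ℓ.Prime]

/-- Averaging an orbit yields a fixed point for a group of order prime to `ℓ`. -/
theorem exists_le_stabilizer [Finite K] (A : Subgroup (TwistedAffine K (ZMod ℓ)))
    (hA : ¬ ℓ ∣ Nat.card A) : ∃ f : K → ZMod ℓ, A ≤ stabilizer _ f := by
  have := Fintype.ofFinite A
  have hA' : (Fintype.card A : ZMod ℓ) ≠ 0 := by
    rwa [Ne, ZMod.natCast_eq_zero_iff, ← Nat.card_eq_fintype_card]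
  refine ⟨fun x ↦ (Fintype.card A : ZMod ℓ)⁻¹ * ∑ r : A, (r.1 • (0 : K → ZMod ℓ)) x,
    fun q hq ↦ ?_⟩
  rw [mem_stabilizer_iff]
  funext x
  have h : ∑ r : A, (r.1 • (0 : K → ZMod ℓ)) x =
      ∑ r : A, (r.1 • (0 : K → ZMod ℓ)) (q.a * x + q.b) + Fintype.card A * q.v x := by
    rw [← Equiv.sum_comp (Equiv.mulLeft (⟨q, hq⟩ : A))]
    simp only [Equiv.coe_mulLeft, Subgroup.coe_mul, mul_smul]
    simp only [smul_apply q, Finset.sum_add_distrib, Finset.sum_const, Finset.card_univ,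
      nsmul_eq_mul]
  rw [smul_apply, h, mul_add, inv_mul_cancel_left₀ hA']

/-- A subgroup whose order is divisible by that of `Kˣ` contains an element with linear part a
generator of `Kˣ`, because the kernel of `linearPart` has order prime to that of `Kˣ`. -/
theorem almostParallel_of_le_stabilizer [Finite K] (hK : 2 < Nat.card K) (hℓ : Nat.card K < ℓ)
    {C : Subgroup (TwistedAffine K (ZMod ℓ))} (hC : Nat.card Kˣ ∣ Nat.card C) {f g : K → ZMod ℓ}
    (hf : C ≤ stabilizer _ f) (hg : C ≤ stabilizer _ g) : AlmostParallel 1 f g := by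
  have hcop : (Nat.card Kˣ).Coprime
      (Nat.card (linearPart : TwistedAffine K (ZMod ℓ) →* Kˣ).ker) := by
    rw [card_ker_linearPart, Nat.card_units, Nat.card_zmod]
    refine Nat.Coprime.mul_right ?_ (Nat.Coprime.pow_right _ ?_)
    · have : (Nat.card K - 1) + 1 = Nat.card K := by omega
      rw [← this, Nat.add_sub_cancel]
      simp
    · exact (Nat.coprime_of_lt_prime (by omega) (by omega) Fact.out).symm
  have htop : C.map linearPart = ⊤ := by
    have h := Subgroup.relIndex_mul_relIndex ⊥ _ _ bot_le (inf_le_right :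
      (linearPart : TwistedAffine K (ZMod ℓ) →* Kˣ).ker ⊓ C ≤ C)
    rw [Subgroup.relIndex_bot_left, Subgroup.relIndex_bot_left, Subgroup.inf_relIndex_right,
      Subgroup.relIndex_ker] at h
    refine Subgroup.eq_top_of_le_card _ (Nat.le_of_dvd Nat.card_pos ?_)
    refine Nat.Coprime.dvd_of_dvd_mul_left (Nat.Coprime.coprime_dvd_right
      (Subgroup.card_dvd_of_le inf_le_left) hcop) (h ▸ hC)
  obtain ⟨u, hu⟩ := IsCyclic.exists_generator (α := Kˣ)
  obtain ⟨q, hq, rfl⟩ : u ∈ C.map linearPart := htop ▸ Subgroup.mem_top u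
  exact almostParallel_of_smul_eq hK hu (hf hq) (hg hq)

/-- Along a walk, fixed functions change at one point at a time, up to constants. The divisibility
conditions on the order of `A` persist along the walk: they pass from `A` to `A ⊓ B` and from there
to `B`, the indices being powers of `p`. -/
theorem almostParallel_of_walk [Finite K] {p : ℕ} (hp : p.Prime) (hpK : p.Coprime (Nat.card Kˣ))
    (hpℓ : p < ℓ) (hK : 2 < Nat.card K) (hℓ : Nat.card K < ℓ)
    {A B : FiniteIndexSubgroup (TwistedAffine K (ZMod ℓ))}
    (w : (pLocalCommensurabilityGraph p (TwistedAffine K (ZMod ℓ))).Walk A B)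
    (hA : Nat.card Kˣ ∣ Nat.card A.1) (hAℓ : ¬ ℓ ∣ Nat.card A.1) {f g : K → ZMod ℓ}
    (hf : A.1 ≤ stabilizer _ f) (hg : B.1 ≤ stabilizer _ g) :
    AlmostParallel (w.length + 1) f g := by
  have hℓ' : ℓ.Prime := Fact.out
  induction w generalizing f with
  | nil => simpa using almostParallel_of_le_stabilizer hK hℓ hA hf hg
  | @cons A B C hAB w ih =>
    obtain ⟨s, t, hs, ht⟩ := (pLocalCommensurabilityGraph_adj_iff.1 hAB).2.exists_eq_pow hp
    have h₁ := Subgroup.relIndex_mul_relIndex ⊥ _ _ bot_le (inf_le_left : A.1 ⊓ B.1 ≤ A.1)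
    have h₂ := Subgroup.relIndex_mul_relIndex ⊥ _ _ bot_le (inf_le_right : A.1 ⊓ B.1 ≤ B.1)
    rw [Subgroup.relIndex_bot_left, Subgroup.relIndex_bot_left, Subgroup.inf_relIndex_left,
      hs] at h₁
    rw [Subgroup.relIndex_bot_left, Subgroup.relIndex_bot_left, Subgroup.inf_relIndex_right,
      ht] at h₂
    have hC : Nat.card Kˣ ∣ Nat.card (A.1 ⊓ B.1 : Subgroup _) :=
      (hpK.symm.pow_right s).dvd_of_dvd_mul_right (h₁ ▸ hA)
    have hBℓ : ¬ ℓ ∣ Nat.card B.1 := by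
      intro h
      rw [← h₂, hℓ'.dvd_mul] at h
      rcases h with h | h
      · exact hAℓ (h₁ ▸ h.mul_right _)
      · exact absurd (Nat.le_of_dvd hp.pos (hℓ'.dvd_of_dvd_pow h)) hpℓ.not_ge
    obtain ⟨f', hf'⟩ := exists_le_stabilizer B.1 hBℓ
    have h₃ := almostParallel_of_le_stabilizer hK hℓ hC (inf_le_left.trans hf)
      (inf_le_right.trans hf')
    have h₄ := ih (h₂ ▸ hC.mul_right _) hBℓ hf' hg
    convert h₃.trans h₄ using 1
    rw [SimpleGraph.Walk.length_cons]
    ring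

end Distance

end TwistedAffine

open TwistedAffine MulAction in
/-- For every `p` and `N` some finite group has a distant pair: the stabilizers of the zero function
and of an injective function in a group of twisted affine transformations over a large field of
characteristic `p`. -/
theorem exists_finite_group_hasDistantPair {p : ℕ} (hp : p.Prime) (N : ℕ) :
    ∃ (Q : Type) (_ : Group Q) (_ : Finite Q) (c : ℕ), HasDistantPair p N c Q := by
  have : Fact p.Prime := ⟨hp⟩
  let K := GaloisField p (N + 3)
  have hcard : Nat.card K = p ^ (N + 3) := GaloisField.card p _ (by omega)
  have hlarge : N + 3 < Nat.card K := hcard ▸ Nat.lt_pow_self hp.one_lt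
  have : Finite K := Nat.finite_of_card_ne_zero (by omega)
  obtain ⟨ℓ, hℓK, hℓ⟩ := Nat.exists_infinite_primes (Nat.card K + 1)
  have : Fact ℓ.Prime := ⟨hℓ⟩
  have hpK : p ≤ Nat.card K := hcard ▸ Nat.le_self_pow (by omega) p
  have hunits : p.Coprime (Nat.card Kˣ) := by
    rw [Nat.card_units, hcard]
    have h : (p ^ (N + 3) - 1) + 1 = p ^ (N + 3) := Nat.sub_add_cancel (Nat.one_le_pow _ _ hp.pos)
    refine Nat.Coprime.coprime_dvd_left (dvd_pow_self p (Nat.succ_ne_zero (N + 2))) ?_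
    rw [← h, Nat.add_sub_cancel]
    simp
  obtain ⟨g, hg⟩ : ∃ g : K → ZMod ℓ, Function.Injective g := by
    have := Fintype.ofFinite K
    obtain ⟨ι⟩ := Function.Embedding.nonempty_of_card_le (α := K) (β := ZMod ℓ) (by
      rw [← Nat.card_eq_fintype_card, ZMod.card]; omega)
    exact ⟨ι, ι.injective⟩
  have hreach := reachable_stabilizer (M := ZMod ℓ) hp hcard 0 g
  refine ⟨TwistedAffine K (ZMod ℓ), inferInstance, inferInstance, _, _, _, rfl, hreach, ?_⟩
  obtain ⟨w, hw⟩ := hreach.exists_walk_length_eq_dist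
  have hcop : ¬ ℓ ∣ Nat.card Kˣ * Nat.card K := by
    rw [hℓ.dvd_mul, Nat.card_units]
    rintro (h | h)
    · exact absurd (Nat.le_of_dvd (by omega) h) (by omega)
    · exact absurd (Nat.le_of_dvd (by omega) h) (by omega)
  have h := almostParallel_of_walk hp hunits (by omega) (by omega) (by omega) w
    (by rw [card_stabilizer]; exact Dvd.intro _ rfl) (by rwa [card_stabilizer]) le_rfl le_rfl
  have := card_le_of_almostParallel_zero hg h
  omega

theorem corollary3 (G : Type u) [Group G] (hG : IsLargeGroup G)
    (p : ℕ) (hp : p.Prime) (N : ℕ) (hN : 0 < N) :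
    ∃ S : Set (GraphGeodesic (pLocalCommensurabilityGraph p G)),
      S.Infinite ∧
      (∀ γ ∈ S, ∀ γ' ∈ S, γ ≠ γ' → γ.component ≠ γ'.component) ∧
      ∀ γ ∈ S, N < γ.length := by
  obtain ⟨Q, _, _, c, hQ⟩ := exists_finite_group_hasDistantPair hp N
  obtain ⟨K, _, _, β, _, f, hf⟩ := hG.exists_normal_surjective
  refine exists_geodesics_of_hasDistantPair (c := c * K.index) (m := Nat.card Q) hp fun n hn ↦ ?_
  rw [mul_right_comm]
  exact ((hQ.freeGroup hp hn).of_surjective hp f hf).of_normal hp K
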